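/- Throughout, $\ell^2(\mathbb N)$ is the complex Hilbert space of square-summable sequences with canonical basis $(e_j)_{j\in\mathbb N}$. Let $F$ be a unitary operator on $\ell^2(\mathbb N)$, let $\mathcal U\subseteq \ell^2(\mathbb N)$ be an $r$-dimensional linear subspace, and let $p=(p_j)_{j\in\mathbb N}$ be a probability distribution on $\mathbb N$. Define the local coherences $\alpha_j=\sup_{x\in\mathcal U,\ \|x\|=1}|(Fx)_j|$, and let $\mu=\mu_{\mathcal U}(F,p)$ be the smallest constant such that $\alpha_j\le \mu\sqrt{p_j}$ for all $j$ with $p_j>0$; assume that such a constant exists and that $\mu\ge 1$. Let $m\in\mathbb N$ and let $J_1,\dots,J_m$ be i.i.d. random indices with $\mathbb P(J_i=j)=p_j$ for all $j\in\mathbb N$; put $s_i=e_{J_i}$. The sampling operator $S$ sends a complex sequence $y$ to $Sy\in\mathbb C^m$, $(Sy)_i=\langle y,s_i\rangle=y_{J_i}$. The weight operator $D$ acts on complex sequences by $(Dy)_j=y_j/\sqrt{p_j}$ if $p_j>0$ and $(Dy)_j=0$ if $p_j=0$. The operator $\hat I$ is the coordinate projection of $\ell^2(\mathbb N)$ given by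 $(\hat Iy)_j=y_j$ if $p_j>0$ and $(\hat Iy)_j=0$ if $p_j=0$. Norms are those of $\ell^2(\mathbb N)$ and the Euclidean norm of $\mathbb C^m$. Then for all $\varepsilon\in(0,1)$ and $\delta\in(0,1]$, $$\mathbb P\left[\ \sup_{x\in\mathcal U,\ \|x\|=1}\left|\frac1m\|SDFx\|^2-\|\hat IFx\|^2\right|\le\delta\ \right]\ \ge\ 1-\varepsilon \qquad\text{provided}\qquad m\ \ge\ \frac{4\mu^2}{\delta^2}\log\left(\frac{2r}{\varepsilon}\right).$$ -/

import Mathlib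

open MeasureTheory ProbabilityTheory

namespace GenCS

noncomputable section

/-- The complex Hilbert space `ℓ²(ℕ)`. -/
abbrev Ell2 : Type := lp (fun _ : ℕ => ℂ) 2

/-- The `j`-th canonical basis vector `e_j` of `ℓ²(ℕ)`. -/
def stdVec (j : ℕ) : Ell2 := lp.single 2 j (1 : ℂ)

/-- The inclusion of `ℓ²(ℕ)` into the space of all complex sequences. -/
def toSeq : Ell2 →ₗ[ℂ] (ℕ → ℂ) where
  toFun x := fun j => x j
  map_add' _ _ := rfl
  map_smul' _ _ := rfl

/-- The weight operator `D`: `(D y)_j = y_j / √p_j` if `p_j > 0`, and `(D y)_j = 0` if `p_j = 0`.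
If `p` has infinite support then `D` is unbounded, and `D y` need not be square summable for
`y ∈ ℓ²(ℕ)`; `D` is therefore taken as an operator on the space of all sequences. -/
def weightOp (p : PMF ℕ) : (ℕ → ℂ) →ₗ[ℂ] (ℕ → ℂ) where
  toFun y := fun j => if p j = 0 then 0 else y j / ((Real.sqrt (p j).toReal : ℝ) : ℂ)
  map_add' y z := by
    funext j
    by_cases h : p j = 0 <;> simp [h, add_div]
  map_smul' c y := by
    funext j
    by_cases h : p j = 0 <;> simp [h, mul_div_assoc]

/-- The sampling operator `S` with rows `s_i = e_{J i}`: `(S y)_i = ⟨y, e_{J i}⟩ = y_{J i}`,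
with values in `ℂ^m` with its Euclidean norm. -/
def sampleOp {m : ℕ} (J : Fin m → ℕ) : (ℕ → ℂ) →ₗ[ℂ] EuclideanSpace ℂ (Fin m) where
  toFun y := WithLp.toLp 2 (fun i => y (J i))
  map_add' _ _ := rfl
  map_smul' _ _ := rfl

/-- On `ℓ²(ℕ)` the sampling operator is given by inner products with the vectors `e_{J i}`
(Mathlib's inner product is conjugate linear in its first argument). -/
theorem sampleOp_toSeq_apply {m : ℕ} (J : Fin m → ℕ) (x : Ell2) (i : Fin m) :
    sampleOp J (toSeq x) i = inner ℂ (stdVec (J i)) x := by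
  have h : sampleOp J (toSeq x) i = x (J i) := rfl
  rw [h, stdVec, lp.inner_single_left]
  simp

/-- The operator `Î = diag(1_{supp p})` on `ℓ²(ℕ)`. -/
def suppProj (p : PMF ℕ) : Ell2 →ₗ[ℂ] Ell2 where
  toFun x := ⟨fun j => if p j = 0 then 0 else x j,
    (lp.memℓp x).mono' (fun j => by
      by_cases h : p j = 0 <;> simp [h])⟩
  map_add' x y := by
    ext j
    change (if p j = 0 then (0 : ℂ) else x j + y j) =
      (if p j = 0 then 0 else x j) + (if p j = 0 then 0 else y j)
    by_cases h : p j = 0 <;> simp [h]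
  map_smul' c x := by
    ext j
    by_cases h : p j = 0 <;> simp [h]

/-- The local coherence `α_j = sup {|(F x)_j| : x ∈ U, ‖x‖ = 1}` of a subspace `U` with respect to
`F`. (The set is bounded above by `1`; for `U = 0` it is empty and `α_j = 0`.) -/
def localCoherence (F : Ell2 ≃ₗᵢ[ℂ] Ell2) (U : Submodule ℂ Ell2) (j : ℕ) : ℝ :=
  sSup {t : ℝ | ∃ x ∈ U, ‖x‖ = 1 ∧ t = ‖F x j‖}

/-- The constants `B` such that `α_j ≤ B √p_j` for all `j` with `p_j > 0`. -/
def coherenceBounds (F : Ell2 ≃ₗᵢ[ℂ] Ell2) (U : Submodule ℂ Ell2) (p : PMF ℕ) : Set ℝ :=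
  {B : ℝ | ∀ j : ℕ, 0 < p j → localCoherence F U j ≤ B * Real.sqrt (p j).toReal}

/-- `μ_U(F, p)`: the smallest `B` such that `α_j ≤ B √p_j` for all `j` with `p_j > 0`.
If no such constant exists (infinite coherence), the value is the junk value `0`. -/
def coherence (F : Ell2 ≃ₗᵢ[ℂ] Ell2) (U : Submodule ℂ Ell2) (p : PMF ℕ) : ℝ :=
  sInf (coherenceBounds F U p)

theorem localCoherence_nonneg (F : Ell2 ≃ₗᵢ[ℂ] Ell2) (U : Submodule ℂ Ell2) (j : ℕ) :
    0 ≤ localCoherence F U j := by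
  apply Real.sSup_nonneg
  rintro t ⟨x, -, -, rfl⟩
  exact norm_nonneg _

/-- As soon as a constant exists, `coherence` is the smallest one. In particular this holds
whenever `1 ≤ coherence F U p`. -/
theorem isLeast_coherence (F : Ell2 ≃ₗᵢ[ℂ] Ell2) (U : Submodule ℂ Ell2) (p : PMF ℕ)
    (h : (coherenceBounds F U p).Nonempty) :
    IsLeast (coherenceBounds F U p) (coherence F U p) := by
  have hpos : ∀ j, 0 < p j → 0 < Real.sqrt (p j).toReal := fun j hj =>
    Real.sqrt_pos.2 (ENNReal.toReal_pos hj.ne' (p.apply_ne_top j))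
  have hbdd : BddBelow (coherenceBounds F U p) := by
    obtain ⟨j, hj⟩ := p.support_nonempty
    have hj' : 0 < p j := (p.apply_pos_iff j).2 hj
    refine ⟨0, fun B hB => ?_⟩
    have h1 := (localCoherence_nonneg F U j).trans (hB j hj')
    exact nonneg_of_mul_nonneg_left h1 (hpos j hj')
  refine ⟨fun j hj => ?_, fun B hB => csInf_le hbdd hB⟩
  rw [← div_le_iff₀ (hpos j hj)]
  refine le_csInf h fun B hB => ?_
  rw [div_le_iff₀ (hpos j hj)]
  exact hB j hj

/-- The supremum over unit vectors `x ∈ U` of `|(1/m) ‖S D F x‖² - ‖Î F x‖²|`,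
taken in the extended reals. -/
def ripDeviation {m : ℕ} (F : Ell2 ≃ₗᵢ[ℂ] Ell2) (U : Submodule ℂ Ell2) (p : PMF ℕ)
    (J : Fin m → ℕ) : EReal :=
  ⨆ x : {x : Ell2 // x ∈ U ∧ ‖x‖ = 1},
    ((|1 / (m : ℝ) * ‖sampleOp J (weightOp p (toSeq (F x.1)))‖ ^ 2 - ‖suppProj p (F x.1)‖ ^ 2| : ℝ)
      : EReal)

end

end GenCS

/-! In an orthonormal basis of `U`, `‖SDFx‖²` is the quadratic form of `∑ X_{J_i}`, where `X_j` is
the rank-one Gram matrix of row `j` of `DF` on `U`. Coherence gives `0 ≤ X_j ≤ μ²`, and the common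
mean `A` is the Gram matrix of `ÎF` on `U`, so `0 ≤ A ≤ 1`. The claim is thus concentration of a sum
of independent bounded positive matrices (`measureReal_exists_abs_dotProduct_sum_sub_le`).

This is the Ahlswede–Winter argument: `norm_trace_exp_add_le` (Golden–Thompson) and independence
split off one summand at a time, so the trace of the exponential of `θ ∑ (X - A)` has mean at most
`r exp(mθ²μ²)`. Markov with `θ = δ/(2μ²)` bounds each tail by `r exp(-mδ²/(4μ²))`; two tails give
`2r`. Golden–Thompson follows from a trace inequality for powers `2 ^ k` and the Lie product
formula. -/

namespace Matrix

/-! ### Trace inequalities for powers of products. -/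

open scoped Matrix.Norms.L2Operator MatrixOrder ComplexOrder
open NormedSpace (exp)

variable {n : Type*} [Fintype n] [DecidableEq n]

theorem trace_mul_pow_comm (A B : Matrix n n ℂ) (k : ℕ) :
    trace ((A * B) ^ k) = trace ((B * A) ^ k) := by
  cases k with
  | zero => simp
  | succ k =>
    have h : ∀ k : ℕ, (A * B) ^ k * A = A * (B * A) ^ k := by
      intro k
      induction k with
      | zero => simp
      | succ k ih => rw [pow_succ', mul_assoc, ih, pow_succ']; simp only [mul_assoc]
    rw [pow_succ, ← mul_assoc, h, trace_mul_comm, ← mul_assoc, ← pow_succ']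

omit [DecidableEq n] in
theorem trace_mul_conjTranspose_self (A : Matrix n n ℂ) :
    trace (A * Aᴴ) = ((∑ q : n × n, ‖A q.1 q.2‖ ^ 2 : ℝ) : ℂ) := by
  simp [trace, mul_apply, Fintype.sum_prod_type, Complex.mul_conj, Complex.normSq_eq_norm_sq]

omit [DecidableEq n] in
/-- The Cauchy–Schwarz inequality for the Hilbert–Schmidt inner product. -/
theorem norm_trace_mul_sq_le (A B : Matrix n n ℂ) :
    ‖trace (A * B)‖ ^ 2 ≤ ‖trace (A * Aᴴ)‖ * ‖trace (Bᴴ * B)‖ := by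
  have hB : trace (Bᴴ * B) = ((∑ q : n × n, ‖B q.2 q.1‖ ^ 2 : ℝ) : ℂ) := by
    have := trace_mul_conjTranspose_self Bᴴ
    simpa using this
  have h0 : trace (A * B) = ∑ q : n × n, A q.1 q.2 * B q.2 q.1 := by
    simp [trace, mul_apply, Fintype.sum_prod_type]
  rw [trace_mul_conjTranspose_self, hB, Complex.norm_of_nonneg (by positivity),
    Complex.norm_of_nonneg (by positivity), h0]
  calc ‖∑ q : n × n, A q.1 q.2 * B q.2 q.1‖ ^ 2
      ≤ (∑ q : n × n, ‖A q.1 q.2‖ * ‖B q.2 q.1‖) ^ 2 := by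
        gcongr
        refine (norm_sum_le _ _).trans (le_of_eq ?_)
        simp
    _ ≤ _ := Finset.sum_mul_sq_le_sq_mul_sq _ _ _

/-- The two claims feed each other. The first at `k + 1` is itself at `k` for `X ^ 2`, then the
second for `Xᴴ * X` and `X * Xᴴ`, then Cauchy–Schwarz. The second at `k + 1` is the first for `P *
Q`, cyclicity, then itself at `k` for `P ^ 2` and `Q ^ 2`. -/
theorem norm_trace_two_pow_le (k : ℕ) :
    (∀ X : Matrix n n ℂ, ‖trace (X ^ 2 ^ (k + 1))‖ ≤ ‖trace ((X * Xᴴ) ^ 2 ^ k)‖) ∧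
    (∀ P Q : Matrix n n ℂ, P.IsHermitian → Q.IsHermitian →
      ‖trace ((P * Q) ^ 2 ^ k)‖ ≤ ‖trace (P ^ 2 ^ k * Q ^ 2 ^ k)‖) := by
  induction k with
  | zero =>
    refine ⟨fun X => ?_, fun P Q _ _ => by simp⟩
    have h := norm_trace_mul_sq_le X X
    rw [trace_mul_comm Xᴴ X, ← sq, ← sq] at h
    simpa using le_of_sq_le_sq h (norm_nonneg _)
  | succ k ih =>
    obtain ⟨ihS, ihT⟩ := ih
    constructor
    · intro X
      have hP : (Xᴴ * X).IsHermitian := isHermitian_conjTranspose_mul_self X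
      have hQ : (X * Xᴴ).IsHermitian := isHermitian_mul_conjTranspose_self X
      have h1 : trace ((X ^ 2 * (X ^ 2)ᴴ) ^ 2 ^ k) =
          trace (((Xᴴ * X) * (X * Xᴴ)) ^ 2 ^ k) := by
        rw [show X ^ 2 * (X ^ 2)ᴴ = (X * X * Xᴴ) * Xᴴ by
          rw [sq, conjTranspose_mul]; simp only [mul_assoc], trace_mul_pow_comm]
        simp only [mul_assoc]
      have h2 := norm_trace_mul_sq_le ((Xᴴ * X) ^ 2 ^ k) ((X * Xᴴ) ^ 2 ^ k)
      rw [(hP.pow _).eq, (hQ.pow _).eq, ← pow_add, ← pow_add, trace_mul_pow_comm Xᴴ X, ← sq,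
        ← two_mul, ← pow_succ'] at h2
      have h3 := ihS (X ^ 2)
      rw [h1, ← pow_mul, ← pow_succ'] at h3
      exact (h3.trans (ihT _ _ hP hQ)).trans (le_of_sq_le_sq h2 (norm_nonneg _))
    · intro P Q hP hQ
      refine (ihS (P * Q)).trans ?_
      have h1 : trace ((P * Q * (P * Q)ᴴ) ^ 2 ^ k) = trace ((P ^ 2 * Q ^ 2) ^ 2 ^ k) := by
        rw [conjTranspose_mul, hP.eq, hQ.eq,
          show P * Q * (Q * P) = (P * Q ^ 2) * P by rw [sq]; simp only [mul_assoc],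
          trace_mul_pow_comm, ← mul_assoc, ← sq]
      rw [h1]
      refine (ihT _ _ (hP.pow 2) (hQ.pow 2)).trans (le_of_eq ?_)
      rw [← pow_mul, ← pow_mul, ← pow_succ']

end Matrix

/-! ### The Lie product formula. -/

section LieProduct

open NormedSpace (exp)
open Filter Topology

variable {𝔸 : Type*} [NormedRing 𝔸] [NormOneClass 𝔸]

/-- Telescoping; the extra factor `M` avoids the exponent `k - 1`. -/
theorem norm_pow_sub_pow_le (x y : 𝔸) {M : ℝ} (hx : ‖x‖ ≤ M) (hy : ‖y‖ ≤ M) (k : ℕ) :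
    ‖x ^ k - y ^ k‖ * M ≤ k * M ^ k * ‖x - y‖ := by
  have hM : 0 ≤ M := (norm_nonneg x).trans hx
  induction k with
  | zero => simp
  | succ k ih =>
    have h : x ^ (k + 1) - y ^ (k + 1) = (x ^ k - y ^ k) * x + y ^ k * (x - y) := by
      rw [pow_succ, pow_succ]; noncomm_ring
    calc ‖x ^ (k + 1) - y ^ (k + 1)‖ * M
        ≤ (‖x ^ k - y ^ k‖ * M + M ^ k * ‖x - y‖) * M := by
          gcongr
          rw [h]
          refine (norm_add_le _ _).trans (add_le_add ?_ ?_)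
          · exact (norm_mul_le _ _).trans (by gcongr)
          · refine (norm_mul_le _ _).trans ?_
            gcongr
            exact (norm_pow_le y k).trans (by gcongr)
      _ ≤ (k * M ^ k * ‖x - y‖ + M ^ k * ‖x - y‖) * M := by gcongr
      _ = _ := by push_cast; ring

variable [NormedAlgebra ℝ 𝔸] [CompleteSpace 𝔸]

omit [CompleteSpace 𝔸] in
theorem NormedSpace.norm_exp_le_exp_norm (x : 𝔸) : ‖exp x‖ ≤ Real.exp ‖x‖ := by
  rw [NormedSpace.exp_eq_tsum ℝ, Real.exp_eq_exp_ℝ, NormedSpace.exp_eq_tsum ℝ]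
  refine tsum_of_norm_bounded (NormedSpace.expSeries_summable' (𝕂 := ℝ) ‖x‖).hasSum fun k => ?_
  rw [norm_smul, norm_inv, Real.norm_natCast, smul_eq_mul]
  gcongr
  exact norm_pow_le x k

/-- The Lie product formula. -/
theorem tendsto_exp_mul_exp_pow (a b : 𝔸) :
    Tendsto (fun k : ℕ => (exp ((k : ℝ)⁻¹ • a) * exp ((k : ℝ)⁻¹ • b)) ^ k) atTop
      (𝓝 (exp (a + b))) := by
  -- The two curves agree to first order at `0`, so their distance at `1/k` is `o(1/k)`, which beats
  -- the factor `k` from telescoping.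
  have hd : HasDerivAt (fun t : ℝ => exp (t • (a + b)) - exp (t • a) * exp (t • b)) 0 0 := by
    have h := (hasDerivAt_exp_smul_const (𝕂 := ℝ) (a + b) 0).sub
      ((hasDerivAt_exp_smul_const (𝕂 := ℝ) a 0).mul (hasDerivAt_exp_smul_const (𝕂 := ℝ) b 0))
    refine h.congr_deriv ?_
    simp
  have hlim : Tendsto (fun k : ℕ => (k : ℝ) * ‖exp ((k : ℝ)⁻¹ • (a + b)) -
      exp ((k : ℝ)⁻¹ • a) * exp ((k : ℝ)⁻¹ • b)‖) atTop (𝓝 0) := by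
    have h1 := hd.tendsto_slope.norm
    have h2 : Tendsto (fun k : ℕ => (k : ℝ)⁻¹) atTop (𝓝[≠] 0) := by
      refine tendsto_nhdsWithin_iff.2 ⟨tendsto_inv_atTop_nhds_zero_nat, ?_⟩
      filter_upwards [eventually_gt_atTop 0] with k hk
      simpa using hk.ne'
    have h3 := h1.comp h2
    simp only [norm_zero] at h3
    refine h3.congr fun k => ?_
    simp [slope, norm_smul]
  rw [← tendsto_sub_nhds_zero_iff, tendsto_zero_iff_norm_tendsto_zero]
  have hlim' := hlim.const_mul (Real.exp (‖a‖ + ‖b‖))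
  rw [mul_zero] at hlim'
  refine squeeze_zero' (Eventually.of_forall fun _ => norm_nonneg _) ?_ hlim'
  filter_upwards [eventually_gt_atTop 0] with k hk
  have hk' : (0 : ℝ) < k := by exact_mod_cast hk
  -- A common bound for both bases whose `k`-th power does not depend on `k`.
  set M := Real.exp ((k : ℝ)⁻¹ * (‖a‖ + ‖b‖)) with hM
  have hM1 : 1 ≤ M := Real.one_le_exp (by positivity)
  have hMk : M ^ k = Real.exp (‖a‖ + ‖b‖) := by
    rw [hM, ← Real.exp_nat_mul]; congr 1; field_simp
  have hpow : exp (a + b) = exp ((k : ℝ)⁻¹ • (a + b)) ^ k := by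
    let +nondep : NormedAlgebra ℚ 𝔸 := .restrictScalars ℚ ℝ 𝔸
    rw [← NormedSpace.exp_nsmul, ← Nat.cast_smul_eq_nsmul ℝ, smul_smul,
      mul_inv_cancel₀ hk'.ne', one_smul]
  have hx : ‖exp ((k : ℝ)⁻¹ • (a + b))‖ ≤ M := by
    refine (NormedSpace.norm_exp_le_exp_norm _).trans (Real.exp_le_exp.2 ?_)
    rw [norm_smul, norm_inv, Real.norm_natCast]
    gcongr
    exact norm_add_le a b
  have hy : ‖exp ((k : ℝ)⁻¹ • a) * exp ((k : ℝ)⁻¹ • b)‖ ≤ M := by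
    rw [hM, mul_add, Real.exp_add]
    refine (norm_mul_le _ _).trans ?_
    gcongr <;>
    · refine (NormedSpace.norm_exp_le_exp_norm _).trans (Real.exp_le_exp.2 ?_)
      rw [norm_smul, norm_inv, Real.norm_natCast]
  rw [hpow, norm_sub_rev]
  refine (le_mul_of_one_le_right (norm_nonneg _) hM1).trans ?_
  refine (norm_pow_sub_pow_le _ _ hx hy k).trans (le_of_eq ?_)
  rw [hMk]; ring

end LieProduct

/-! ### The Golden–Thompson inequality. -/

namespace Matrix

open scoped Matrix.Norms.L2Operator MatrixOrder ComplexOrder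
open NormedSpace (exp)
open Filter Topology

variable {n : Type*} [Fintype n] [DecidableEq n]

/-- The **Golden–Thompson inequality**. -/
theorem norm_trace_exp_add_le {A B : Matrix n n ℂ} (hA : A.IsHermitian) (hB : B.IsHermitian) :
    ‖trace (exp (A + B))‖ ≤ ‖trace (exp A * exp B)‖ := by
  rcases isEmpty_or_nonempty n with hn | hn
  · simp [trace]
  -- The subsequence `2 ^ k` suffices, and it matches the exponents of the trace inequality.
  have h := (tendsto_exp_mul_exp_pow A B).comp (tendsto_pow_atTop_atTop_of_one_lt one_lt_two)
  have hc : Continuous fun X : Matrix n n ℂ => ‖trace X‖ := by fun_prop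
  refine le_of_tendsto' ((hc.tendsto _).comp h) fun k => ?_
  have hk : ((2 ^ k : ℕ) : ℝ) ≠ 0 := by positivity
  have hpow : ∀ C : Matrix n n ℂ, exp C = exp (((2 ^ k : ℕ) : ℝ)⁻¹ • C) ^ 2 ^ k := by
    intro C
    rw [← Matrix.exp_nsmul, ← Nat.cast_smul_eq_nsmul ℝ, smul_smul, mul_inv_cancel₀ hk, one_smul]
  have hh : ∀ {C : Matrix n n ℂ}, C.IsHermitian →
      (exp (((2 ^ k : ℕ) : ℝ)⁻¹ • C)).IsHermitian := fun hC => (hC.smul (by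
        simp [IsSelfAdjoint])).exp
  have h2 := (norm_trace_two_pow_le k).2 _ _ (hh hA) (hh hB)
  rw [← hpow, ← hpow] at h2
  exact h2

end Matrix

/-! ### Exponential moments and matrix Bernstein. -/

namespace Matrix

open scoped Matrix.Norms.L2Operator MatrixOrder ComplexOrder
open NormedSpace (exp)

variable {n : Type*} [Fintype n] [DecidableEq n]

/-- The scalar inequality on `[-1, 1]`, which contains the spectrum, passes through the functional
calculus. -/
theorem exp_le_one_add_add_sq {Y : Matrix n n ℂ} (hY : Y.IsHermitian) (hY1 : ‖Y‖ ≤ 1) :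
    exp Y ≤ 1 + Y + Y ^ 2 := by
  rcases isEmpty_or_nonempty n with hn | hn
  · exact le_of_eq (Subsingleton.elim _ _)
  have hs : IsSelfAdjoint Y := hY
  have h1 : cfc (fun x : ℝ => 1 + x + x ^ 2) Y = 1 + Y + Y ^ 2 := by
    rw [cfc_add (a := Y) (fun x : ℝ => 1 + x) (fun x => x ^ 2), cfc_const_add 1 _ Y, cfc_id' ℝ Y,
      cfc_pow_id (R := ℝ) Y 2, map_one]
  rw [← CFC.real_exp_eq_normedSpace_exp hs, ← h1]
  refine cfc_mono fun x hx => ?_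
  have hx1 : |x| ≤ 1 := (spectrum.norm_le_norm_of_mem hx).trans hY1
  have := (abs_le.1 (Real.abs_exp_sub_one_sub_id_le hx1)).2
  linarith

theorem PosSemidef.trace_mul_nonneg {P Q : Matrix n n ℂ} (hP : P.PosSemidef)
    (hQ : Q.PosSemidef) : 0 ≤ trace (P * Q) := by
  obtain ⟨S, rfl⟩ := CStarAlgebra.nonneg_iff_eq_star_mul_self.1 hP.nonneg
  rw [mul_assoc, trace_mul_comm]
  exact (hQ.mul_mul_conjTranspose_same S).trace_nonneg

theorem re_trace_mul_le {P Q : Matrix n n ℂ} {c : ℝ} (hP : 0 ≤ P) (hQ : Q ≤ c • 1) :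
    (trace (P * Q)).re ≤ c * (trace P).re := by
  have h := (nonneg_iff_posSemidef.1 hP).trace_mul_nonneg hQ
  rw [mul_sub, trace_sub, mul_smul_comm, mul_one, trace_smul] at h
  have := (Complex.le_def.1 h).1
  simp at this
  linarith

/-- The complement of the projection onto `v` is positive, so its trace against `P` is nonnegative.
-/
theorem dotProduct_mulVec_le_trace {P : Matrix n n ℂ} (hP : 0 ≤ P) {v : n → ℂ}
    (hv : star v ⬝ᵥ v = 1) : star v ⬝ᵥ P *ᵥ v ≤ trace P := by
  set Q : Matrix n n ℂ := 1 - vecMulVec v (star v) with hQ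
  have hQH : Qᴴ = Q := by simp [hQ, conjTranspose_vecMulVec]
  have hQQ : Qᴴ * Q = Q := by
    rw [hQH, hQ, sub_mul, mul_sub, mul_sub, vecMulVec_mul_vecMulVec, hv]
    simp
  have h := (nonneg_iff_posSemidef.1 hP).trace_mul_nonneg (hQQ ▸ posSemidef_conjTranspose_mul_self Q)
  rw [hQ, mul_sub, trace_sub, mul_one, mul_vecMulVec, trace_vecMulVec, dotProduct_comm] at h
  exact sub_nonneg.1 h

/-- The tangent line of the exponential at `t`, lifted to `H` and tested on `v`, replaces any choice
of a top eigenvalue. -/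
theorem exp_le_re_trace_exp {H : Matrix n n ℂ} (hH : H.IsHermitian) {v : n → ℂ}
    (hv : star v ⬝ᵥ v = 1) {t : ℝ} (ht : t ≤ (star v ⬝ᵥ H *ᵥ v).re) :
    Real.exp t ≤ (trace (exp H)).re := by
  have hs : IsSelfAdjoint H := hH
  set a : ℝ := Real.exp t
  have h1 : cfc (fun x : ℝ => a * (1 - t) + a * x) H = (a * (1 - t)) • 1 + a • H := by
    rw [cfc_const_add _ _ H, cfc_const_mul _ _ H, cfc_id' ℝ H, Algebra.algebraMap_eq_smul_one]
  have h2 : (a * (1 - t)) • 1 + a • H ≤ exp H := by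
    rw [← CFC.real_exp_eq_normedSpace_exp hs, ← h1]
    refine cfc_mono fun x _ => ?_
    have h3 := Real.add_one_le_exp (x - t)
    have h4 : Real.exp x = a * Real.exp (x - t) := by rw [← Real.exp_add]; ring_nf
    rw [h4]
    nlinarith [Real.exp_pos t]
  have h5 := (PosSemidef.re_dotProduct_nonneg h2 v)
  have h6 := (Complex.le_def.1 (dotProduct_mulVec_le_trace hs.exp_nonneg hv)).1
  simp only [sub_mulVec, add_mulVec, smul_mulVec, one_mulVec, dotProduct_sub, dotProduct_add,
    dotProduct_smul, hv] at h5
  simp at h5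
  nlinarith [Real.exp_pos t]

/-- The real part of the trace as a continuous linear functional. -/
noncomputable def reTraceCLM (n : Type*) [Fintype n] [DecidableEq n] :
    Matrix n n ℂ →L[ℝ] ℝ :=
  Complex.reCLM ∘L LinearMap.toContinuousLinearMap (traceLinearMap n ℝ ℂ)

omit [Fintype n] [DecidableEq n] in
theorem isHermitian_sum {ι : Type*} (s : Finset ι) {f : ι → Matrix n n ℂ}
    (hf : ∀ i ∈ s, (f i).IsHermitian) : (∑ i ∈ s, f i).IsHermitian :=
  (conjTranspose_sum s f).trans (Finset.sum_congr rfl hf)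

theorem continuous_exp : Continuous (exp : Matrix n n ℂ → Matrix n n ℂ) := by
  let +nondep : NormedAlgebra ℚ (Matrix n n ℂ) := .restrictScalars ℚ ℝ _
  exact NormedSpace.exp_continuous

variable {Ω α ι : Type*} [MeasurableSpace Ω] [MeasurableSpace α] {P : Measure Ω}
  [IsProbabilityMeasure P]

/-- The Ahlswede–Winter bound for the trace of the exponential of a sum of independent random
Hermitian matrices. -/
theorem integral_re_trace_exp_sum_le {J : ι → Ω → α} (hJ : ∀ i, Measurable (J i))
    (hind : iIndepFun J P) {f : ι → α → Matrix n n ℂ} (hf : ∀ i, StronglyMeasurable (f i))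
    (hfH : ∀ i a, (f i a).IsHermitian) {R : ℝ} (hfR : ∀ i a, ‖f i a‖ ≤ R) {c : ℝ} (hc : 0 ≤ c)
    (hfc : ∀ i, ∫ ω, exp (f i (J i ω)) ∂P ≤ c • 1) (s : Finset ι) :
    Integrable (fun ω => exp (∑ i ∈ s, f i (J i ω))) P ∧
    ∫ ω, (trace (exp (∑ i ∈ s, f i (J i ω)))).re ∂P ≤ Fintype.card n * c ^ s.card := by
  classical
  rcases isEmpty_or_nonempty n with hn | hn
  · have : ∀ ω, exp (∑ i ∈ s, f i (J i ω)) = 0 := fun ω => Subsingleton.elim _ _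
    simp [trace, this]
  have hbound : ∀ (s : Finset ι) (x : ι → α), ‖exp (∑ i ∈ s, f i (x i))‖ ≤ Real.exp (s.card * R) :=
    fun s x => (NormedSpace.norm_exp_le_exp_norm _).trans (Real.exp_le_exp.2
      ((norm_sum_le_of_le s fun i _ => hfR i (x i)).trans (by simp)))
  have hint : ∀ s : Finset ι, Integrable (fun ω => exp (∑ i ∈ s, f i (J i ω))) P := by
    intro s
    refine Integrable.of_bound (C := Real.exp (s.card * R)) ?_
      (Filter.Eventually.of_forall fun ω => hbound s fun i => J i ω)
    refine (continuous_exp.comp_stronglyMeasurable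
      (Finset.stronglyMeasurable_fun_sum s fun i _ =>
        (hf i).comp_measurable (hJ i))).aestronglyMeasurable
  refine ⟨hint s, ?_⟩
  induction s using Finset.induction_on with
  | empty => simp
  | insert a s ha ih =>
    have hXY : IndepFun (fun ω (i : s) => J i ω) (J a) P := by
      have h := hind.indepFun_finset s {a} (by simpa using ha) hJ
      exact h.comp (φ := id) (ψ := fun y : ({a} : Finset ι) → α => y ⟨a, by simp⟩) measurable_id
        (measurable_pi_apply _)
    have hXm : Measurable (fun ω (i : s) => J i ω) := measurable_pi_lambda _ fun i => hJ i
    have hsum : ∀ ω, ∑ i : s, f i (J i ω) = ∑ i ∈ s, f i (J i ω) := fun ω =>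
      Finset.sum_coe_sort s fun i => f i (J i ω)
    have hWm : StronglyMeasurable fun x : s → α => exp (∑ i : s, f i (x i)) :=
      continuous_exp.comp_stronglyMeasurable
        (Finset.stronglyMeasurable_fun_sum _ fun i _ =>
          (hf i).comp_measurable (measurable_pi_apply i))
    have hEm : StronglyMeasurable fun x : α => exp (f a x) :=
      continuous_exp.comp_stronglyMeasurable (hf a)
    have hWi : Integrable (fun x : s → α => exp (∑ i : s, f i (x i)))
        (P.map fun ω (i : s) => J i ω) := by
      rw [integrable_map_measure hWm.aestronglyMeasurable hXm.aemeasurable]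
      simpa only [Function.comp_def, hsum] using hint s
    have hEi' : Integrable (fun ω => exp (f a (J a ω))) P := by
      simpa using hint {a}
    have hEi : Integrable (fun x : α => exp (f a x)) (P.map (J a)) := by
      rw [integrable_map_measure hEm.aestronglyMeasurable (hJ a).aemeasurable]
      exact hEi'
    have hprod := hXY.integral_bilin_comp_comp hXm.aemeasurable (hJ a).aemeasurable hWi hEi
      (ContinuousLinearMap.mul ℝ (Matrix n n ℂ))
    simp only [ContinuousLinearMap.mul_apply', hsum] at hprod
    have hSH : ∀ ω, (∑ i ∈ s, f i (J i ω)).IsHermitian := fun ω =>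
      isHermitian_sum s fun i _ => hfH i _
    have hpos : ∀ ω, 0 ≤ exp (∑ i ∈ s, f i (J i ω)) := fun ω =>
      IsSelfAdjoint.exp_nonneg (hSH ω)
    have hpi : Integrable (fun ω => exp (∑ i ∈ s, f i (J i ω)) * exp (f a (J a ω))) P := by
      refine (hint s).mul_bdd (c := Real.exp (1 * R)) hEi'.aestronglyMeasurable ?_
      refine Filter.Eventually.of_forall fun ω => ?_
      simpa using hbound {a} fun i => J i ω
    have hre : ∀ {g : Ω → Matrix n n ℂ}, Integrable g P →
        ∫ ω, (trace (g ω)).re ∂P = (trace (∫ ω, g ω ∂P)).re := fun hg =>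
      (reTraceCLM n).integral_comp_comm hg
    -- Golden–Thompson separates the new summand, independence factors the expectation, and the
    -- bound `c • 1` comes out of the trace because the other factor is positive.
    calc ∫ ω, (trace (exp (∑ i ∈ insert a s, f i (J i ω)))).re ∂P
        ≤ ∫ ω, (trace (exp (∑ i ∈ s, f i (J i ω)) * exp (f a (J a ω)))).re ∂P := by
          refine integral_mono ((reTraceCLM n).integrable_comp (hint _))
            ((reTraceCLM n).integrable_comp hpi) fun ω => ?_
          have h0 : 0 ≤ trace (exp (∑ i ∈ s, f i (J i ω)) * exp (f a (J a ω))) :=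
            (nonneg_iff_posSemidef.1 (hpos ω)).trace_mul_nonneg
              (nonneg_iff_posSemidef.1 (IsSelfAdjoint.exp_nonneg (hfH a (J a ω))))
          have h1 := norm_trace_exp_add_le (hSH ω) (hfH a (J a ω))
          rw [← Complex.re_eq_norm.2 h0] at h1
          simp only [Finset.sum_insert ha]
          rw [add_comm]
          exact (Complex.re_le_norm _).trans h1
      _ = (trace ((∫ ω, exp (∑ i ∈ s, f i (J i ω)) ∂P) * ∫ ω, exp (f a (J a ω)) ∂P)).re := by
          rw [hre hpi, hprod]
      _ ≤ c * (trace (∫ ω, exp (∑ i ∈ s, f i (J i ω)) ∂P)).re :=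
          re_trace_mul_le (integral_nonneg hpos) (hfc a)
      _ = c * ∫ ω, (trace (exp (∑ i ∈ s, f i (J i ω)))).re ∂P := by rw [hre (hint s)]
      _ ≤ c * (Fintype.card n * c ^ s.card) := by gcongr
      _ = _ := by rw [Finset.card_insert_of_notMem ha]; ring

/-- A matrix Bernstein inequality, with the parameter `θ` of the exponential moment left free. -/
theorem measureReal_exists_le_dotProduct_sum_mulVec_le {J : ι → Ω → α}
    (hJ : ∀ i, Measurable (J i)) (hind : iIndepFun J P) {f : ι → α → Matrix n n ℂ}
    (hf : ∀ i, StronglyMeasurable (f i)) (hfH : ∀ i a, (f i a).IsHermitian) {θ σ : ℝ}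
    (hθ : 0 ≤ θ) (hfR : ∀ i a, ‖θ • f i a‖ ≤ 1) (hf0 : ∀ i, ∫ ω, f i (J i ω) ∂P = 0)
    (hfσ : ∀ i, ∫ ω, f i (J i ω) ^ 2 ∂P ≤ σ • 1) (s : Finset ι) (t : ℝ) :
    P.real {ω | ∃ v : n → ℂ, star v ⬝ᵥ v = 1 ∧
      t ≤ (star v ⬝ᵥ (∑ i ∈ s, f i (J i ω)) *ᵥ v).re} ≤
      Fintype.card n * Real.exp (s.card * (θ ^ 2 * σ) - θ * t) := by
  have hgH : ∀ i a, (θ • f i a).IsHermitian := fun i a => (hfH i a).smul (by simp [IsSelfAdjoint])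
  have hgm : ∀ i, StronglyMeasurable fun a => θ • f i a := fun i => (hf i).const_smul θ
  have hgi : ∀ i, Integrable (fun ω => θ • f i (J i ω)) P := fun i =>
    Integrable.of_bound (C := 1) ((hgm i).comp_measurable (hJ i)).aestronglyMeasurable
      (Filter.Eventually.of_forall fun ω => hfR i _)
  have hgi2 : ∀ i, Integrable (fun ω => (θ • f i (J i ω)) ^ 2) P := fun i => by
    refine Integrable.of_bound (C := 1)
      (((hgm i).comp_measurable (hJ i)).pow 2).aestronglyMeasurable
      (Filter.Eventually.of_forall fun ω => ?_)
    rw [sq]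
    exact (norm_mul_le _ _).trans (mul_le_one₀ (hfR _ _) (norm_nonneg _) (hfR _ _))
  have hc : ∀ i, ∫ ω, exp (θ • f i (J i ω)) ∂P ≤ Real.exp (θ ^ 2 * σ) • 1 := by
    intro i
    have hei : Integrable (fun ω => exp (θ • f i (J i ω))) P := by
      rcases isEmpty_or_nonempty n with hn | hn
      · simp [Subsingleton.elim (exp _ : Matrix n n ℂ) 0]
      refine Integrable.of_bound (C := Real.exp 1) (continuous_exp.comp_stronglyMeasurable
        ((hgm i).comp_measurable (hJ i))).aestronglyMeasurable
        (Filter.Eventually.of_forall fun ω => ?_)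
      exact (NormedSpace.norm_exp_le_exp_norm _).trans (Real.exp_le_exp.2 (hfR _ _))
    -- The linear term has mean zero; only the variance survives.
    calc ∫ ω, exp (θ • f i (J i ω)) ∂P
        ≤ ∫ ω, (1 + θ • f i (J i ω) + (θ • f i (J i ω)) ^ 2) ∂P :=
          integral_mono hei (((integrable_const _).add (hgi i)).add (hgi2 i)) fun ω =>
            exp_le_one_add_add_sq (hgH i _) (hfR i _)
      _ = 1 + θ ^ 2 • ∫ ω, f i (J i ω) ^ 2 ∂P := by
          have h1 : Integrable (fun _ : Ω => (1 : Matrix n n ℂ)) P := integrable_const _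
          have h2 : Integrable (fun ω => 1 + θ • f i (J i ω)) P := h1.add (hgi i)
          rw [integral_add h2 (hgi2 i), integral_add h1 (hgi i), integral_smul, hf0 i]
          simp [smul_pow, integral_smul]
      _ ≤ 1 + θ ^ 2 • (σ • 1) := by gcongr; exact hfσ i
      _ = (1 + θ ^ 2 * σ) • (1 : Matrix n n ℂ) := by rw [add_smul, one_smul, smul_smul]
      _ ≤ _ := smul_le_smul_of_nonneg_right (by linarith [Real.add_one_le_exp (θ ^ 2 * σ)])
          zero_le_one
  obtain ⟨hint, hmgf⟩ := integral_re_trace_exp_sum_le (f := fun i a => θ • f i a) hJ hind hgm hgH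
    hfR (Real.exp_pos _).le hc s
  have hH : ∀ ω, (∑ i ∈ s, θ • f i (J i ω)).IsHermitian := fun ω =>
    isHermitian_sum s fun i _ => hgH i _
  have hmarkov := mul_meas_ge_le_integral_of_nonneg (μ := P)
    (f := fun ω => (trace (exp (∑ i ∈ s, θ • f i (J i ω)))).re)
    (Filter.Eventually.of_forall fun ω => (Complex.le_def.1
      (nonneg_iff_posSemidef.1 (IsSelfAdjoint.exp_nonneg (hH ω))).trace_nonneg).1)
    ((reTraceCLM n).integrable_comp hint) (Real.exp (θ * t))
  -- One trace event covers all unit vectors at once, so no net over the sphere is needed.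
  have hsub : {ω | ∃ v : n → ℂ, star v ⬝ᵥ v = 1 ∧
      t ≤ (star v ⬝ᵥ (∑ i ∈ s, f i (J i ω)) *ᵥ v).re} ⊆
      {ω | Real.exp (θ * t) ≤ (trace (exp (∑ i ∈ s, θ • f i (J i ω)))).re} := by
    rintro ω ⟨v, hv, ht⟩
    refine exp_le_re_trace_exp (hH ω) hv ?_
    rw [← Finset.smul_sum, smul_mulVec, dotProduct_smul, Complex.smul_re, smul_eq_mul]
    gcongr
  have h1 := (mul_le_mul_of_nonneg_left (measureReal_mono (μ := P) hsub)
    (Real.exp_pos (θ * t)).le).trans (hmarkov.trans hmgf)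
  rw [← Real.exp_nat_mul] at h1
  rw [Real.exp_sub, mul_div_assoc', le_div_iff₀ (Real.exp_pos _), mul_comm]
  exact h1

end Matrix

/-! ### Concentration for bounded positive matrices. -/

namespace Matrix

open scoped Matrix.Norms.L2Operator MatrixOrder ComplexOrder

variable {n : Type*} [Fintype n] [DecidableEq n]

theorem norm_le_of_le_smul_one {H : Matrix n n ℂ} (hH : H.IsHermitian) {c : ℝ} (hc : 0 ≤ c)
    (h1 : H ≤ c • 1) (h2 : -(c • 1) ≤ H) : ‖H‖ ≤ c := by
  rcases isEmpty_or_nonempty n with hn | hn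
  · rwa [Subsingleton.elim H 0, norm_zero]
  have hs : IsSelfAdjoint H := hH
  rw [← neg_smul] at h2
  rw [← Algebra.algebraMap_eq_smul_one] at h1 h2
  have h1' := (le_algebraMap_iff_spectrum_le (R := ℝ) (a := H) hs).1 h1
  have h2' := (algebraMap_le_iff_le_spectrum (R := ℝ) (a := H) hs).1 h2
  rcases CStarAlgebra.norm_or_neg_norm_mem_spectrum (a := H) hs with h | h
  · exact h1' _ h
  · linarith [h2' _ h]

/-- From `x² ≤ c x` on `[0, c]`; this makes the variance bound linear in `L` rather than quadratic.
-/
theorem sq_le_smul {X : Matrix n n ℂ} (h0 : 0 ≤ X) {c : ℝ} (h1 : X ≤ c • 1) :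
    X ^ 2 ≤ c • X := by
  have hs : IsSelfAdjoint X := .of_nonneg h0
  rw [← Algebra.algebraMap_eq_smul_one] at h1
  have h1' := (le_algebraMap_iff_spectrum_le (R := ℝ) (a := X) hs).1 h1
  have e1 : cfc (fun x : ℝ => x ^ 2) X = X ^ 2 := cfc_pow_id (R := ℝ) X 2
  have e2 : cfc (fun x : ℝ => c * x) X = c • X := by rw [cfc_const_mul _ _ X, cfc_id' ℝ X]
  rw [← e1, ← e2]
  refine cfc_mono fun x hx => ?_
  have hx0 : 0 ≤ x := spectrum_nonneg_of_nonneg h0 hx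
  nlinarith [h1' x hx]

variable {Ω α : Type*} [MeasurableSpace Ω] [MeasurableSpace α] {P : Measure Ω}
  [IsProbabilityMeasure P]

/-- Concentration of the quadratic form of a sum of independent positive semidefinite matrices
bounded by `L` with a common mean `A ≤ 1`. -/
theorem measureReal_exists_abs_dotProduct_sum_sub_le {m : ℕ} {J : Fin m → Ω → α}
    (hJ : ∀ i, Measurable (J i)) (hind : iIndepFun J P) {X : α → Matrix n n ℂ}
    (hX : StronglyMeasurable X) (hX0 : ∀ a, 0 ≤ X a) {L : ℝ} (hL : 1 ≤ L)
    (hXL : ∀ a, X a ≤ L • 1) {A : Matrix n n ℂ} (hA : ∀ i, ∫ ω, X (J i ω) ∂P = A)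
    (hA0 : 0 ≤ A) (hA1 : A ≤ 1) {δ : ℝ} (hδ0 : 0 < δ) (hδ1 : δ ≤ 1) :
    P.real {ω | ∃ v : n → ℂ, star v ⬝ᵥ v = 1 ∧
      m * δ ≤ |(star v ⬝ᵥ (∑ i, X (J i ω)) *ᵥ v).re - m * (star v ⬝ᵥ A *ᵥ v).re|} ≤
      2 * (Fintype.card n * Real.exp (-(m * (δ ^ 2 / (4 * L))))) := by
  have hL0 : 0 < L := by linarith
  have hAH : A.IsHermitian := (nonneg_iff_posSemidef.1 hA0).isHermitian
  have hXH : ∀ a, (X a - A).IsHermitian := fun a =>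
    (nonneg_iff_posSemidef.1 (hX0 a)).isHermitian.sub hAH
  have h1L : (1 : Matrix n n ℂ) ≤ L • 1 := by
    calc (1 : Matrix n n ℂ) = (1 : ℝ) • 1 := (one_smul _ _).symm
      _ ≤ L • 1 := smul_le_smul_of_nonneg_right hL zero_le_one
  -- Positivity of `X` and `A`, with `A ≤ 1 ≤ L`, gives `L` where the triangle inequality would give
  -- `L + 1`.
  have hnorm : ∀ a, ‖X a - A‖ ≤ L := by
    intro a
    refine norm_le_of_le_smul_one (hXH a) hL0.le ?_ ?_
    · exact (sub_le_self _ hA0).trans (hXL a)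
    · rw [neg_le_sub_iff_le_add]
      exact (hA1.trans h1L).trans (le_add_of_nonneg_left (hX0 a))
  have hXn : ∀ a, ‖X a‖ ≤ L := fun a =>
    norm_le_of_le_smul_one (nonneg_iff_posSemidef.1 (hX0 a)).isHermitian hL0.le (hXL a)
      ((neg_nonpos.2 (smul_nonneg hL0.le zero_le_one)).trans (hX0 a))
  have hXJ : ∀ i, StronglyMeasurable fun ω => X (J i ω) := fun i => hX.comp_measurable (hJ i)
  have hXi : ∀ i, Integrable (fun ω => X (J i ω)) P := fun i =>
    Integrable.of_bound (C := L) (hXJ i).aestronglyMeasurable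
      (Filter.Eventually.of_forall fun ω => hXn _)
  have hX2i : ∀ i, Integrable (fun ω => X (J i ω) ^ 2) P := fun i =>
    Integrable.of_bound (C := L * L) ((hXJ i).pow 2).aestronglyMeasurable
      (Filter.Eventually.of_forall fun ω => by
        rw [sq]
        exact (norm_mul_le _ _).trans (mul_le_mul (hXn _) (hXn _) (norm_nonneg _) hL0.le))
  have hmean : ∀ i, ∫ ω, (X (J i ω) - A) ∂P = 0 := fun i => by
    rw [integral_sub (hXi i) (integrable_const _), hA i]
    simp
  have hA2 : 0 ≤ A ^ 2 := by
    have h := posSemidef_conjTranspose_mul_self A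
    rw [hAH.eq, ← sq] at h
    exact nonneg_iff_posSemidef.2 h
  have hvar : ∀ i, ∫ ω, (X (J i ω) - A) ^ 2 ∂P ≤ L • 1 := fun i => by
    have e : ∀ ω, (X (J i ω) - A) ^ 2 = X (J i ω) ^ 2 - X (J i ω) * A - A * X (J i ω) + A ^ 2 :=
      fun ω => by rw [sq, sq, sq]; noncomm_ring
    have hl : ∫ ω, X (J i ω) * A ∂P = A * A := by
      have h := (ContinuousLinearMap.mul ℝ (Matrix n n ℂ)).flip A |>.integral_comp_comm (hXi i)
      simpa [hA i] using h
    have hr : ∫ ω, A * X (J i ω) ∂P = A * A := by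
      have h := (ContinuousLinearMap.mul ℝ (Matrix n n ℂ) A).integral_comp_comm (hXi i)
      simpa [hA i] using h
    have hli : Integrable (fun ω => X (J i ω) * A) P :=
      ((ContinuousLinearMap.mul ℝ (Matrix n n ℂ)).flip A).integrable_comp (hXi i)
    have hri : Integrable (fun ω => A * X (J i ω)) P :=
      (ContinuousLinearMap.mul ℝ (Matrix n n ℂ) A).integrable_comp (hXi i)
    have h3 : Integrable (fun ω => X (J i ω) ^ 2 - X (J i ω) * A) P := (hX2i i).sub hli
    have h4 : Integrable (fun ω => X (J i ω) ^ 2 - X (J i ω) * A - A * X (J i ω)) P := h3.sub hri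
    simp_rw [e]
    rw [integral_add h4 (integrable_const _), integral_sub h3 hri, integral_sub (hX2i i) hli,
      hl, hr]
    calc ∫ ω, X (J i ω) ^ 2 ∂P - A * A - A * A + ∫ _, A ^ 2 ∂P
        = ∫ ω, X (J i ω) ^ 2 ∂P - A ^ 2 := by simp [sq]
      _ ≤ ∫ ω, X (J i ω) ^ 2 ∂P := sub_le_self _ hA2
      _ ≤ ∫ ω, L • X (J i ω) ∂P :=
          integral_mono (hX2i i) ((hXi i).smul L) fun ω => sq_le_smul (hX0 _) (hXL _)
      _ = L • A := by rw [integral_smul, hA i]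
      _ ≤ L • 1 := smul_le_smul_of_nonneg_left hA1 hL0.le
  -- This `θ` minimises `θ² L - θ δ`, with value `-δ² / (4L)`; `δ ≤ 1` keeps the scaled matrices in
  -- the unit ball.
  have hθ : (0 : ℝ) ≤ δ / (2 * L) := by positivity
  have hθn : ∀ a, ‖(δ / (2 * L)) • (X a - A)‖ ≤ 1 := fun a => by
    rw [norm_smul, Real.norm_of_nonneg hθ]
    calc δ / (2 * L) * ‖X a - A‖ ≤ δ / (2 * L) * L := by gcongr; exact hnorm a
      _ = δ / 2 := by field_simp
      _ ≤ 1 := by linarith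
  have hexp : (m : ℝ) * ((δ / (2 * L)) ^ 2 * L) - δ / (2 * L) * (m * δ) =
      -(m * (δ ^ 2 / (4 * L))) := by field_simp; ring
  have hup := measureReal_exists_le_dotProduct_sum_mulVec_le hJ hind (f := fun _ a => X a - A)
    (fun _ => hX.sub stronglyMeasurable_const) (fun _ => hXH) hθ (fun _ => hθn) hmean hvar
    Finset.univ (m * δ)
  have hlow := measureReal_exists_le_dotProduct_sum_mulVec_le hJ hind
    (f := fun _ a => -(X a - A))
    (fun _ => (hX.sub stronglyMeasurable_const).neg) (fun _ a => (hXH a).neg) hθ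
    (fun _ a => by rw [smul_neg, norm_neg]; exact hθn a)
    (fun i => by rw [integral_neg, hmean i, neg_zero])
    (fun i => by simpa only [neg_sq] using hvar i)
    Finset.univ (m * δ)
  rw [Finset.card_univ, Fintype.card_fin, hexp] at hup hlow
  have hq : ∀ ω (v : n → ℂ), (star v ⬝ᵥ (∑ i, (X (J i ω) - A)) *ᵥ v).re =
      (star v ⬝ᵥ (∑ i, X (J i ω)) *ᵥ v).re - m * (star v ⬝ᵥ A *ᵥ v).re := fun ω v => by
    rw [Finset.sum_sub_distrib, sub_mulVec, dotProduct_sub, Complex.sub_re, Finset.sum_const,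
      Finset.card_univ, Fintype.card_fin, smul_mulVec, dotProduct_smul, nsmul_eq_mul]
    simp
  have hq' : ∀ ω (v : n → ℂ), (star v ⬝ᵥ (∑ i, -(X (J i ω) - A)) *ᵥ v).re =
      -((star v ⬝ᵥ (∑ i, X (J i ω)) *ᵥ v).re - m * (star v ⬝ᵥ A *ᵥ v).re) := fun ω v => by
    rw [← hq, Finset.sum_neg_distrib, neg_mulVec, dotProduct_neg, Complex.neg_re]
  simp only [hq] at hup
  simp only [hq'] at hlow
  refine (measureReal_mono (μ := P) ?_).trans
    ((measureReal_union_le _ _).trans ((add_le_add hup hlow).trans (two_mul _).ge))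
  rintro ω ⟨v, hv, h⟩
  exact (le_abs.1 h).imp (fun h => ⟨v, hv, h⟩) fun h => ⟨v, hv, h⟩

end Matrix

/-! ### Gram matrices of the sampled rows, and the conclusion. -/

namespace GenCS

open scoped Matrix.Norms.L2Operator MatrixOrder ComplexOrder
open Matrix

theorem norm_apply_le_localCoherence_mul (F : Ell2 ≃ₗᵢ[ℂ] Ell2) {U : Submodule ℂ Ell2} {x : Ell2}
    (hx : x ∈ U) (j : ℕ) : ‖F x j‖ ≤ localCoherence F U j * ‖x‖ := by
  have hle : ∀ y : Ell2, ‖F y j‖ ≤ ‖y‖ := fun y =>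
    (lp.norm_apply_le_norm two_ne_zero (F y) j).trans (F.norm_map y).le
  rcases eq_or_ne x 0 with rfl | h0
  · simp
  have hpos : 0 < ‖x‖ := norm_pos_iff.2 h0
  rw [← div_le_iff₀ hpos]
  refine le_csSup ⟨1, ?_⟩ ⟨((‖x‖⁻¹ : ℝ) : ℂ) • x, U.smul_mem _ hx, ?_, ?_⟩
  · rintro t ⟨y, -, hy, rfl⟩
    exact (hle y).trans hy.le
  · rw [norm_smul]
    simp [hpos.ne']
  · rw [map_smul, lp.coeFn_smul, Pi.smul_apply, norm_smul]
    simp [div_eq_inv_mul]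

theorem toReal_pos_of_ne_zero {p : PMF ℕ} {j : ℕ} (h : p j ≠ 0) : 0 < (p j).toReal :=
  ENNReal.toReal_pos h (p.apply_ne_top j)

/-- The factor `√p_j` in the coherence bound cancels the weight, so the bound is uniform in `j`. -/
theorem norm_weightOp_le (F : Ell2 ≃ₗᵢ[ℂ] Ell2) {U : Submodule ℂ Ell2} {p : PMF ℕ} {B : ℝ}
    (hB : B ∈ coherenceBounds F U p) (hB0 : 0 ≤ B) {x : Ell2} (hx : x ∈ U) (j : ℕ) :
    ‖weightOp p (toSeq (F x)) j‖ ≤ B * ‖x‖ := by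
  change ‖if p j = 0 then (0 : ℂ) else F x j / ((Real.sqrt (p j).toReal : ℝ) : ℂ)‖ ≤ _
  split_ifs with h
  · rw [norm_zero]; positivity
  · have hs : 0 < Real.sqrt (p j).toReal := Real.sqrt_pos.2 (toReal_pos_of_ne_zero h)
    rw [norm_div, Complex.norm_of_nonneg hs.le, div_le_iff₀ hs]
    calc ‖F x j‖ ≤ localCoherence F U j * ‖x‖ := norm_apply_le_localCoherence_mul F hx j
      _ ≤ B * Real.sqrt (p j).toReal * ‖x‖ := by gcongr; exact hB j (pos_iff_ne_zero.2 h)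
      _ = _ := by ring

theorem norm_sq_eq_tsum (x : Ell2) : ‖x‖ ^ 2 = ∑' j, ‖x j‖ ^ 2 := by
  have h := lp.norm_rpow_eq_tsum (p := 2) (by simp) x
  simpa using h

theorem norm_suppProj_le (p : PMF ℕ) (x : Ell2) : ‖suppProj p x‖ ≤ ‖x‖ := by
  have hs : ∀ y : Ell2, Summable fun j => ‖y j‖ ^ 2 := fun y => by
    simpa using (lp.memℓp y).summable (by simp)
  refine le_of_sq_le_sq ?_ (norm_nonneg _)
  rw [norm_sq_eq_tsum, norm_sq_eq_tsum]
  refine (hs _).tsum_le_tsum (fun j => ?_) (hs _)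
  change ‖if p j = 0 then (0 : ℂ) else x j‖ ^ 2 ≤ _
  split_ifs <;> simp

/-- The squared weight `1 / p_j` cancels the sampling probability; hence `Î` appears in the mean. -/
theorem norm_suppProj_sq (p : PMF ℕ) (x : Ell2) :
    ‖suppProj p x‖ ^ 2 = ∑' j, (p j).toReal • ‖weightOp p (toSeq x) j‖ ^ 2 := by
  rw [norm_sq_eq_tsum]
  refine tsum_congr fun j => ?_
  change ‖if p j = 0 then (0 : ℂ) else x j‖ ^ 2 = (p j).toReal •
    ‖if p j = 0 then (0 : ℂ) else x j / ((Real.sqrt (p j).toReal : ℝ) : ℂ)‖ ^ 2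
  split_ifs with h
  · simp
  · have h0 := toReal_pos_of_ne_zero h
    rw [norm_div, Complex.norm_of_nonneg (Real.sqrt_nonneg _), div_pow, Real.sq_sqrt h0.le,
      smul_eq_mul, mul_div_cancel₀ _ h0.ne']

section Gram

variable {ι : Type*} [Fintype ι] [DecidableEq ι] {U : Submodule ℂ Ell2}

/-- The `j`-th row of the matrix of `D F` restricted to `U`. -/
noncomputable def rowVec (F : Ell2 ≃ₗᵢ[ℂ] Ell2) (p : PMF ℕ) (b : OrthonormalBasis ι ℂ U) (j : ℕ) :
    ι → ℂ :=
  fun k => weightOp p (toSeq (F (b k))) j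

/-- The rank-one Gram matrix of the `j`-th row of `D F` restricted to `U`. -/
noncomputable def rowGram (F : Ell2 ≃ₗᵢ[ℂ] Ell2) (p : PMF ℕ) (b : OrthonormalBasis ι ℂ U) (j : ℕ) :
    Matrix ι ι ℂ :=
  vecMulVec (star (rowVec F p b j)) (rowVec F p b j)

/-- The element of `U` with the given coordinates. -/
noncomputable def ofCoords (b : OrthonormalBasis ι ℂ U) (v : ι → ℂ) : U :=
  b.repr.symm (WithLp.toLp 2 v)

variable (F : Ell2 ≃ₗᵢ[ℂ] Ell2) (p : PMF ℕ) (b : OrthonormalBasis ι ℂ U)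

omit [DecidableEq ι] in
theorem dotProduct_star_self_eq (v : ι → ℂ) : star v ⬝ᵥ v = ((‖ofCoords b v‖ ^ 2 : ℝ) : ℂ) := by
  rw [ofCoords, LinearIsometryEquiv.norm_map, EuclideanSpace.norm_sq_eq]
  simp [dotProduct, Complex.conj_mul']

omit [DecidableEq ι] in
theorem rowVec_dotProduct (v : ι → ℂ) (j : ℕ) :
    rowVec F p b j ⬝ᵥ v = weightOp p (toSeq (F (ofCoords b v))) j := by
  have h : ((ofCoords b v : U) : Ell2) = ∑ k, v k • ((b k : U) : Ell2) := by
    rw [ofCoords, ← b.sum_repr_symm (WithLp.toLp 2 v)]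
    simp
  rw [h]
  simp [map_sum, rowVec, dotProduct, mul_comm]

omit [DecidableEq ι] in
theorem dotProduct_rowGram_mulVec (v : ι → ℂ) (j : ℕ) :
    star v ⬝ᵥ rowGram F p b j *ᵥ v =
      ((‖weightOp p (toSeq (F (ofCoords b v))) j‖ ^ 2 : ℝ) : ℂ) := by
  rw [rowGram, vecMulVec_mulVec, rowVec_dotProduct, dotProduct_smul, star_dotProduct_star,
    rowVec_dotProduct]
  simp [Complex.conj_mul']

omit [DecidableEq ι] in
theorem rowGram_nonneg (j : ℕ) : 0 ≤ rowGram F p b j :=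
  nonneg_iff_posSemidef.2 (posSemidef_vecMulVec_star_self _)

theorem rowGram_le {B : ℝ} (hB : B ∈ coherenceBounds F U p) (hB0 : 0 ≤ B) (j : ℕ) :
    rowGram F p b j ≤ B ^ 2 • 1 := by
  rw [Matrix.le_iff]
  refine PosSemidef.of_dotProduct_mulVec_nonneg ?_ fun v => ?_
  · exact (isHermitian_one.smul (by simp [IsSelfAdjoint])).sub
      (nonneg_iff_posSemidef.1 (rowGram_nonneg F p b j)).isHermitian
  · rw [sub_mulVec, dotProduct_sub, smul_mulVec, one_mulVec, dotProduct_smul,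
      dotProduct_star_self_eq b, dotProduct_rowGram_mulVec, Complex.real_smul, ← Complex.ofReal_mul,
      ← Complex.ofReal_sub, Complex.zero_le_real, ← mul_pow]
    have h := norm_weightOp_le F hB hB0 (ofCoords b v).2 j
    exact sub_nonneg.2 (pow_le_pow_left₀ (norm_nonneg _) h 2)

/-- The quadratic form of a vector as a continuous linear map of the matrix. -/
noncomputable def quadFormCLM (v : ι → ℂ) : Matrix ι ι ℂ →L[ℝ] ℂ :=
  LinearMap.toContinuousLinearMap
    { toFun := fun M => star v ⬝ᵥ M *ᵥ v
      map_add' := fun M N => by rw [add_mulVec, dotProduct_add]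
      map_smul' := fun c M => by rw [smul_mulVec, dotProduct_smul]; rfl }

theorem integrable_rowGram {B : ℝ} (hB : B ∈ coherenceBounds F U p) (hB0 : 0 ≤ B) :
    Integrable (rowGram F p b) p.toMeasure := by
  refine Integrable.of_bound (C := B ^ 2) StronglyMeasurable.of_discrete.aestronglyMeasurable
    (Filter.Eventually.of_forall fun j => ?_)
  exact norm_le_of_le_smul_one (nonneg_iff_posSemidef.1 (rowGram_nonneg F p b j)).isHermitian
    (by positivity) (rowGram_le F p b hB hB0 j)
    ((neg_nonpos.2 (smul_nonneg (by positivity) zero_le_one)).trans (rowGram_nonneg F p b j))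

theorem dotProduct_integral_rowGram_mulVec {B : ℝ} (hB : B ∈ coherenceBounds F U p) (hB0 : 0 ≤ B)
    (v : ι → ℂ) : star v ⬝ᵥ (∫ j, rowGram F p b j ∂p.toMeasure) *ᵥ v =
      ((‖suppProj p (F (ofCoords b v))‖ ^ 2 : ℝ) : ℂ) := by
  have hi := integrable_rowGram F p b hB hB0
  have h := (quadFormCLM v).integral_comp_comm hi
  have hq : ∀ j, quadFormCLM v (rowGram F p b j) =
      ((‖weightOp p (toSeq (F (ofCoords b v))) j‖ ^ 2 : ℝ) : ℂ) :=
    dotProduct_rowGram_mulVec F p b v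
  have hi' : Integrable (fun j => ‖weightOp p (toSeq (F (ofCoords b v))) j‖ ^ 2)
      p.toMeasure := by
    have := ((quadFormCLM v).integrable_comp hi).re
    simpa only [hq, RCLike.re_to_complex, Complex.ofReal_re] using this
  simp only [hq] at h
  rw [integral_complex_ofReal, PMF.integral_eq_tsum p _ hi', ← norm_suppProj_sq] at h
  exact h.symm

theorem integral_rowGram_le_one {B : ℝ} (hB : B ∈ coherenceBounds F U p) (hB0 : 0 ≤ B) :
    ∫ j, rowGram F p b j ∂p.toMeasure ≤ 1 := by
  rw [Matrix.le_iff]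
  refine PosSemidef.of_dotProduct_mulVec_nonneg ?_ fun v => ?_
  · exact isHermitian_one.sub (nonneg_iff_posSemidef.1
      (integral_nonneg (rowGram_nonneg F p b))).isHermitian
  · rw [sub_mulVec, dotProduct_sub, one_mulVec, dotProduct_integral_rowGram_mulVec F p b hB hB0,
      dotProduct_star_self_eq b, ← Complex.ofReal_sub, Complex.zero_le_real]
    have h := (norm_suppProj_le p (F (ofCoords b v))).trans (F.norm_map _).le
    exact sub_nonneg.2 (pow_le_pow_left₀ (norm_nonneg _) h 2)

omit [DecidableEq ι] in
theorem dotProduct_sum_rowGram_mulVec {m : ℕ} (J : Fin m → ℕ) (v : ι → ℂ) :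
    star v ⬝ᵥ (∑ i, rowGram F p b (J i)) *ᵥ v =
      ((‖sampleOp J (weightOp p (toSeq (F (ofCoords b v))))‖ ^ 2 : ℝ) : ℂ) := by
  rw [EuclideanSpace.norm_sq_eq, sum_mulVec, dotProduct_sum, Complex.ofReal_sum]
  exact Finset.sum_congr rfl fun i _ => dotProduct_rowGram_mulVec F p b v (J i)

end Gram

/-- The infimum of the empty set is `0` in `ℝ`, so `1 ≤ μ` already forces a finite coherence bound.
-/
theorem coherence_mem_coherenceBounds {F : Ell2 ≃ₗᵢ[ℂ] Ell2} {U : Submodule ℂ Ell2} {p : PMF ℕ}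
    (h : 1 ≤ coherence F U p) : coherence F U p ∈ coherenceBounds F U p := by
  refine (isLeast_coherence F U p (Set.nonempty_iff_ne_empty.2 fun he => ?_)).1
  rw [coherence, he, Real.sInf_empty] at h
  linarith

theorem one_sub_le_measureReal_ripDeviation_le {Ω : Type*} [MeasurableSpace Ω] (P : Measure Ω)
    [IsProbabilityMeasure P] (F : Ell2 ≃ₗᵢ[ℂ] Ell2) (U : Submodule ℂ Ell2) [FiniteDimensional ℂ U]
    (p : PMF ℕ) (hμ : 1 ≤ coherence F U p) {m : ℕ} (J : Fin m → Ω → ℕ)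
    (hJmeas : ∀ i, Measurable (J i)) (hJindep : iIndepFun J P)
    (hJlaw : ∀ i j, P {ω | J i ω = j} = p j) {ε δ : ℝ} (hε0 : 0 < ε) (hε1 : ε < 1) (hδ0 : 0 < δ)
    (hδ1 : δ ≤ 1)
    (hm : 4 * coherence F U p ^ 2 / δ ^ 2 * Real.log (2 * Module.finrank ℂ U / ε) ≤ m) :
    1 - ε ≤ P.real {ω | ripDeviation F U p (fun i => J i ω) ≤ (δ : EReal)} := by
  set μ := coherence F U p
  have hμ0 : 0 < μ := by linarith
  have hμB : μ ∈ coherenceBounds F U p := coherence_mem_coherenceBounds hμ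
  set r := Module.finrank ℂ U
  set b : OrthonormalBasis (Fin r) ℂ U := stdOrthonormalBasis ℂ U
  have hlaw : ∀ i, P.map (J i) = p.toMeasure := fun i => by
    refine Measure.ext_of_singleton fun j => ?_
    rw [Measure.map_apply (hJmeas i) (measurableSet_singleton j),
      PMF.toMeasure_apply_singleton _ _ (measurableSet_singleton j), ← hJlaw i j]
    rfl
  have hmean : ∀ i, ∫ ω, rowGram F p b (J i ω) ∂P = ∫ j, rowGram F p b j ∂p.toMeasure := fun i => by
    rw [← hlaw i, integral_map (hJmeas i).aemeasurable
      StronglyMeasurable.of_discrete.aestronglyMeasurable]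
  have hconc := measureReal_exists_abs_dotProduct_sum_sub_le hJmeas hJindep
    (X := rowGram F p b) StronglyMeasurable.of_discrete (rowGram_nonneg F p b)
    (one_le_pow₀ hμ : 1 ≤ μ ^ 2) (rowGram_le F p b hμB hμ0.le) hmean
    (integral_nonneg (rowGram_nonneg F p b)) (integral_rowGram_le_one F p b hμB hμ0.le) hδ0 hδ1
  simp only [dotProduct_integral_rowGram_mulVec F p b hμB hμ0.le, dotProduct_star_self_eq b,
    dotProduct_sum_rowGram_mulVec, Complex.ofReal_re, Fintype.card_fin] at hconc
  have hlog : 0 < r → 0 < Real.log (2 * r / ε) := fun hr => by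
    have hr1 : (1 : ℝ) ≤ r := by exact_mod_cast hr
    refine Real.log_pos ?_
    rw [one_lt_div hε0]
    linarith
  have hbound : 2 * (r * Real.exp (-(m * (δ ^ 2 / (4 * μ ^ 2))))) ≤ ε := by
    -- For `r = 0` the condition on `m` says nothing, as `Real.log 0 = 0`, but the left side
    -- vanishes.
    rcases Nat.eq_zero_or_pos r with hr | hr
    · simp [hr, hε0.le]
    have hr0 : (0 : ℝ) < r := by exact_mod_cast hr
    have h : Real.log (2 * r / ε) ≤ m * (δ ^ 2 / (4 * μ ^ 2)) := by
      rw [mul_div_assoc', le_div_iff₀ (by positivity)]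
      rw [div_mul_eq_mul_div, div_le_iff₀ (by positivity)] at hm
      linarith
    calc 2 * (r * Real.exp (-(m * (δ ^ 2 / (4 * μ ^ 2)))))
        ≤ 2 * (r * Real.exp (-Real.log (2 * r / ε))) := by gcongr
      _ = ε := by rw [Real.exp_neg, Real.exp_log (by positivity)]; field_simp
  have hcompl : P.real {ω | ripDeviation F U p (fun i => J i ω) ≤ (δ : EReal)}ᶜ ≤ ε := by
    refine (measureReal_mono (fun ω hω => ?_)).trans (hconc.trans hbound)
    rw [Set.mem_compl_iff, Set.mem_ofPred_eq, not_le, ripDeviation, lt_iSup_iff] at hω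
    obtain ⟨⟨x, hxU, hx1⟩, hx⟩ := hω
    rw [EReal.coe_lt_coe_iff] at hx
    -- A unit vector in `U` forces `r > 0`, hence a positive logarithm and `m > 0`, so `1 / m` can
    -- be cleared.
    have hr : 0 < r := by
      have : Nontrivial U := ⟨⟨⟨x, hxU⟩, 0, fun h => by
        have h0 : x = 0 := congrArg Subtype.val h
        simp [h0] at hx1⟩⟩
      exact Module.finrank_pos
    have hm0 : (0 : ℝ) < m := lt_of_lt_of_le (by have := hlog hr; positivity) hm
    have hv : ofCoords b (b.repr ⟨x, hxU⟩).ofLp = ⟨x, hxU⟩ := by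
      rw [ofCoords, WithLp.toLp_ofLp, LinearIsometryEquiv.symm_apply_apply]
    refine ⟨(b.repr ⟨x, hxU⟩).ofLp, ?_, ?_⟩
    · rw [hv]
      simp [hx1]
    · rw [hv]
      have h := mul_le_mul_of_nonneg_left hx.le hm0.le
      rwa [← abs_of_pos hm0, ← abs_mul, abs_of_pos hm0, mul_sub, ← mul_assoc, mul_one_div_cancel
        hm0.ne', one_mul] at h
  -- Subadditivity needs no measurability of the event.
  have htot := measureReal_union_le (μ := P)
    {ω | ripDeviation F U p (fun i => J i ω) ≤ (δ : EReal)}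
    {ω | ripDeviation F U p (fun i => J i ω) ≤ (δ : EReal)}ᶜ
  rw [Set.union_compl_self, probReal_univ] at htot
  linarith

end GenCS

theorem lemma4p2 {Ω : Type*} [MeasurableSpace Ω] (P : Measure Ω) [IsProbabilityMeasure P]
    (F : GenCS.Ell2 ≃ₗᵢ[ℂ] GenCS.Ell2)
    (r : ℕ) (U : Submodule ℂ GenCS.Ell2) [FiniteDimensional ℂ U] (hr : Module.finrank ℂ U = r)
    (p : PMF ℕ) (hμ : 1 ≤ GenCS.coherence F U p)
    (m : ℕ) (J : Fin m → Ω → ℕ) (hJmeas : ∀ i, Measurable (J i))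
    (hJindep : iIndepFun J P) (hJlaw : ∀ i j, P {ω | J i ω = j} = p j)
    (ε δ : ℝ) (hε : ε ∈ Set.Ioo (0 : ℝ) 1) (hδ : δ ∈ Set.Ioc (0 : ℝ) 1)
    (hm : 4 * GenCS.coherence F U p ^ 2 / δ ^ 2 * Real.log (2 * r / ε) ≤ m) :
    1 - ε ≤ P.real {ω | GenCS.ripDeviation F U p (fun i => J i ω) ≤ (δ : EReal)} := by
  subst hr
  exact GenCS.one_sub_le_measureReal_ripDeviation_le P F U p hμ J hJmeas hJindep hJlaw hε.1 hε.2
    hδ.1 hδ.2 hm
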